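/- **Notation.** Let $q^{1/2}$ be an indeterminate and work in $\mathbb{Q}(q^{1/2})$. For $k\in\mathbb{Z}$ put $[k]=q^{k/2}-q^{-k/2}$, $t_k=[k]^2$ and $t=t_1$. For a partition $\mu$ with parts $\mu_1\ge\mu_2\ge\cdots\ge\mu_{l(\mu)}>0$ write $|\mu|=\sum_i\mu_i$ and $[\mu]=\prod_i[\mu_i]$; $\mu\cup\nu$ is the partition whose parts are those of $\mu$ and $\nu$ together. Fix an integer $r\ge 2$ and $\gamma=(\gamma_1,\dots,\gamma_r)\in\mathbb{Z}^r$; upper indices are cyclic modulo $r$. An *$r$-set* is a triple $(\vec\mu,\vec\nu,\vec\lambda)$ of $r$-tuples of partitions with $|\mu^i|+|\lambda^i|=|\nu^i|+|\lambda^{i+1}|$ for all $i$. Put $d_i=|\mu^i|+|\lambda^i|$, $l(\vec\mu)=\sum_i l(\mu^i)$ and $l(\vec\nu)=\sum_i l(\nu^i)$, and let $\gcd(\vec\mu,\vec\nu,\vec\lambda)$ be the greatest common divisor of all parts of all the partitions. **VEV forests.** For partitions $\mu,\nu$ with $|\mu|=|\nu|$ and $a\in\mathbb{Z}$, the set $\mathrm{Graph}^\bullet_a(\mu,\nu)$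 consists of the forests of plane binary trees produced as follows. Start with a row of vertices (the leaves) with labels $(\mu_{l(\mu)},0),\dots,(\mu_1,0),(-\nu_1,a\nu_1),\dots,(-\nu_{l(\nu)},a\nu_{l(\nu)})$, from left to right. While the row is non-empty: * if its rightmost label is $(0,n)$, remove that vertex from the row; it is the root of a finished tree; * if its rightmost label $(c,n)$ has $c>0$, or its leftmost label $(c,n)$ has $c<0$, discard the whole graph; * otherwise take the rightmost adjacent pair of vertices with labels $(c,m),(c',n)$, $c\ge0>c'$, and follow both branches: (i) interchange the two; (ii) join them to a new vertex $v$ below with label $(c+c',m+n)$, $L(v)$ and $R(v)$ being the left and right vertex of the pair. In (ii), if $(c+c',m+n)\neq(0,0)$ then $v$ replaces the pair in the row; if $(c+c',m+n)=(0,0)$ the pair is removed from the row and $v$ is the root of a finished tree. The components of the resulting forests are called VEV trees. For a VEV tree $T$ let $V_2(T)$ be its set of non-leaf vertices, $(c_v,n_v)$ the label of $v$, and $\zeta_v=c_{L(v)}n_{R(v)}-n_{L(v)}c_{R(v)}$ for $v\in V_2(T)$. Define $$\mathcal A(T)=\begin{cases}\prod_{v\in V_2(T)}[\zeta_v]\,/\,[n_{\rm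 root}] & (n_{\rm root}\ne0),\\[2pt] c_{L({\rm root})}\prod_{v\in V_2(T),\,v\neq{\rm root}}[\zeta_v] & (n_{\rm root}=0),\end{cases}\qquad \mathcal B(T)=\frac{\mathcal A(T)}{\prod_{v\text{ leaf of }T}[\,|c_v|\,]}.$$ **Combined forests.** A combined forest $W\in\mathrm{Comb}^\bullet_\gamma(\vec\mu,\vec\nu,\vec\lambda)$ is obtained from forests $F_i\in\mathrm{Graph}^\bullet_{\gamma_i+2}(\mu^i\cup\lambda^i,\nu^i\cup\lambda^{i+1})$, $1\le i\le r$, by taking their disjoint union and adding, for each part $\lambda^i_j$, an edge $b$ (a *bridge*, with label $h(b)=\lambda^i_j$) joining the leaf of $F_i$ and the leaf of $F_{i-1}$ that come from $\lambda^i_j$. Here, among leaves of $F_i$ with equal labels, the outer ones in the initial row are taken to come from $\lambda^i$ (left leaves) or from $\lambda^{i+1}$ (right leaves), in the order of the index $j$ from the centre outwards. The combined amplitude is $$\mathcal H(W)=(-1)^{l(\vec\mu)+l(\vec\nu)+\sum_i\gamma_id_i}\prod_{T\text{ VEV tree in }W}\mathcal B(T)\prod_{b\text{ bridge of }W}[h(b)]^2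 .$$ For connected $W$, which is in particular non-empty, the cycle rank is $\beta(W)=\#E(W)-\#V(W)+1$. **Proposition.** Let $(\vec\mu,\vec\nu,\vec\lambda)$ be an $r$-set, $k=\gcd(\vec\mu,\vec\nu,\vec\lambda)$, and let $W\in\mathrm{Comb}^\bullet_\gamma(\vec\mu,\vec\nu,\vec\lambda)$ be a connected combined forest. 1. If $\beta(W)=0$, then $t_k\,\mathcal H(W)\in\mathbb{Z}[t]$. 2. If $\beta(W)>0$, then $\mathcal H(W)\in\mathbb{Z}[t]$. -/

import Mathlib

namespace TopString

/-! ### Partitions and `r`-sets -/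

/-- A partition of an arbitrary non-negative integer, with its weight as first component. -/
abbrev Ptn : Type := Σ d : ℕ, Nat.Partition d

/-- The weight `|μ|`. -/
def Ptn.weight (p : Ptn) : ℕ := p.1

/-- The parts `μ₁ ≥ μ₂ ≥ ⋯ ≥ μ_l > 0` of a partition, as a list. -/
def Ptn.parts (p : Ptn) : List ℕ := p.2.parts.sort (fun a b => b ≤ a)

/-- The length `l(μ)`. -/
def Ptn.length (p : Ptn) : ℕ := p.parts.length

/-- An `r`-set: three `r`-tuples of partitions with `|μⁱ| + |λⁱ| = |νⁱ| + |λⁱ⁺¹|` for all `i`.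
The index `i` runs through `Fin r`, in which `i + 1` is taken cyclically. -/
structure RSet (r : ℕ) [NeZero r] where
  mu : Fin r → Ptn
  nu : Fin r → Ptn
  lam : Fin r → Ptn
  balanced : ∀ i, (mu i).weight + (lam i).weight = (nu i).weight + (lam (i + 1)).weight

/-- The degree `dᵢ = |μⁱ| + |λⁱ|` of an `r`-set. -/
def RSet.degree {r : ℕ} [NeZero r] (S : RSet r) (i : Fin r) : ℕ :=
  (S.mu i).weight + (S.lam i).weight

/-- The greatest common divisor of all the parts of all the partitions of an `r`-set. -/
def RSet.gcd {r : ℕ} [NeZero r] (S : RSet r) : ℕ :=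
  Finset.univ.gcd fun i =>
    ((S.mu i).2.parts + (S.nu i).2.parts + (S.lam i).2.parts).gcd

/-! ### Vertex-labelled binary trees -/

/-- Plane binary trees whose leaves carry a leaf index in `ι` and a vertex label `(c, n)`.
In `node L R` the root has `L` as its upper left and `R` as its upper right branch. -/
inductive VTree (ι : Type) : Type
  | leaf (idx : ι) (c n : ℤ) : VTree ι
  | node (L R : VTree ι) : VTree ι

namespace VTree

variable {ι : Type}

/-- First component `c` of the label of the root: `c_v = c_{L(v)} + c_{R(v)}`. -/
def c : VTree ι → ℤ
  | leaf _ c _ => c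
  | node L R => L.c + R.c

/-- Second component `n` of the label of the root: `n_v = n_{L(v)} + n_{R(v)}`. -/
def n : VTree ι → ℤ
  | leaf _ _ n => n
  | node L R => L.n + R.n

/-- The vertices of a tree (`none` is the root of `node L R`). -/
def Vertex : VTree ι → Type
  | leaf _ _ _ => Unit
  | node L R => Option (L.Vertex ⊕ R.Vertex)

/-- The edges of a tree (in `node L R`, each `none` is the edge from the root of `L`,
respectively of `R`, down to the root of the whole tree). -/
def Edge : VTree ι → Type
  | leaf _ _ _ => Empty
  | node L R => Option L.Edge ⊕ Option R.Edge

/-- The root vertex. -/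
def rootVertex : (T : VTree ι) → T.Vertex
  | leaf _ _ _ => ()
  | node _ _ => none

/-- The upper end of an edge. -/
def upper : (T : VTree ι) → T.Edge → T.Vertex
  | leaf _ _ _, e => nomatch e
  | node L _, Sum.inl none => some (Sum.inl L.rootVertex)
  | node L _, Sum.inl (some e) => some (Sum.inl (L.upper e))
  | node _ R, Sum.inr none => some (Sum.inr R.rootVertex)
  | node _ R, Sum.inr (some e) => some (Sum.inr (R.upper e))

/-- The lower end of an edge. -/
def lower : (T : VTree ι) → T.Edge → T.Vertex
  | leaf _ _ _, e => nomatch e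
  | node _ _, Sum.inl none => none
  | node L _, Sum.inl (some e) => some (Sum.inl (L.lower e))
  | node _ _, Sum.inr none => none
  | node _ R, Sum.inr (some e) => some (Sum.inr (R.lower e))

/-- `T.IsLeafAt x v` says that the vertex `v` of `T` is a leaf with leaf index `x`. -/
def IsLeafAt (x : ι) : (T : VTree ι) → T.Vertex → Prop
  | leaf idx _ _, _ => idx = x
  | node _ _, none => False
  | node L _, some (Sum.inl v) => L.IsLeafAt x v
  | node _ R, some (Sum.inr v) => R.IsLeafAt x v

instance instFintypeVertex : (T : VTree ι) → Fintype T.Vertex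
  | leaf _ _ _ => inferInstanceAs (Fintype Unit)
  | node L R =>
    letI := instFintypeVertex L
    letI := instFintypeVertex R
    inferInstanceAs (Fintype (Option (L.Vertex ⊕ R.Vertex)))

instance instFintypeEdge : (T : VTree ι) → Fintype T.Edge
  | leaf _ _ _ => inferInstanceAs (Fintype Empty)
  | node L R =>
    letI := instFintypeEdge L
    letI := instFintypeEdge R
    inferInstanceAs (Fintype (Option L.Edge ⊕ Option R.Edge))

end VTree

/-! ### The graph generating algorithm -/

/-- `Generates s F`: starting from the horizontal list `s` of (roots of) black vertices in the angle
bracket, the algorithm can end with the forest whose connected components are listed in `F`.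

* `done`: the bracket `⟨1⟩` has become a constant.
* `vacuum`: the rightmost vertex has label `(0, n)`; it becomes the root of a finished component.
* `cross`, `merge`, `mergeWhite`: the rightmost adjacent pair of labels `(a, m)`, `(b, n)` with
  `a ≥ 0` and `b < 0` is either interchanged, or merged into a vertex with label `(a + b, m + n)`;
  the latter is a black vertex of the new bracket if its label is not `(0, 0)`, and otherwise the
  white root of a finished component.

Graphs that the algorithm erases (rightmost vertex with `a > 0`, or leftmost with `b < 0`) get no
rule of their own: such an extreme vertex can never be interchanged, merged or finished while it
keeps its place, and no rule moves it, so that `done` is never reached. -/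
inductive Generates {ι : Type} : List (VTree ι) → List (VTree ι) → Prop
  | done : Generates [] []
  | vacuum (s F : List (VTree ι)) (T : VTree ι) (hT : T.c = 0)
      (h : Generates s F) : Generates (s ++ [T]) (T :: F)
  | cross (s t F : List (VTree ι)) (A B : VTree ι) (hA : 0 ≤ A.c) (hB : B.c < 0)
      (hright : List.IsChain (fun x y : VTree ι => ¬ (0 ≤ x.c ∧ y.c < 0)) (B :: t))
      (h : Generates (s ++ B :: A :: t) F) : Generates (s ++ A :: B :: t) F
  | merge (s t F : List (VTree ι)) (A B : VTree ι) (hA : 0 ≤ A.c) (hB : B.c < 0)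
      (hright : List.IsChain (fun x y : VTree ι => ¬ (0 ≤ x.c ∧ y.c < 0)) (B :: t))
      (hne : (A.c + B.c, A.n + B.n) ≠ (0, 0))
      (h : Generates (s ++ VTree.node A B :: t) F) : Generates (s ++ A :: B :: t) F
  | mergeWhite (s t F : List (VTree ι)) (A B : VTree ι) (hA : 0 ≤ A.c) (hB : B.c < 0)
      (hright : List.IsChain (fun x y : VTree ι => ¬ (0 ≤ x.c ∧ y.c < 0)) (B :: t))
      (heq : (A.c + B.c, A.n + B.n) = (0, 0))
      (h : Generates (s ++ t) F) : Generates (s ++ A :: B :: t) (VTree.node A B :: F)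

/-! ### Combined forests -/

/-- Leaf indices of `Fᵢ`. Instead of its position in the initial row, a leaf is indexed by the part
it comes from: the `j`-th part (counted from zero) of `μⁱ` or of `λⁱ` for a left leaf,
of `νⁱ` or of `λⁱ⁺¹` for a right leaf. -/
inductive LeafIndex : Type
  | mu (j : ℕ)
  | lamLeft (j : ℕ)
  | nu (j : ℕ)
  | lamRight (j : ℕ)

/-- The parts of `p ∪ p'` with their origins, in non-increasing order. The sort is stable, so that
among equal parts those of `p` come first. -/
def mergedParts (f g : ℕ → LeafIndex) (p p' : Ptn) : List (LeafIndex × ℕ) :=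
  (p.parts.mapIdx (fun j x => (f j, x)) ++ p'.parts.mapIdx (fun j x => (g j, x))).insertionSort
    (fun x y => y.2 ≤ x.2)

section

variable {r : ℕ} [NeZero r]

/-- The initial row of leaves of `Graph_a(μⁱ ∪ λⁱ, νⁱ ∪ λⁱ⁺¹)`, where `a = γᵢ + 2`: the left leaves,
with labels `(x, 0)` for the parts `x` of `μⁱ ∪ λⁱ` in non-decreasing order, followed by the right
leaves, with labels `(-x, a x)` for the parts `x` of `νⁱ ∪ λⁱ⁺¹` in non-increasing order.
Among equal parts, the leaves of `λⁱ` and `λⁱ⁺¹` are the outer ones. -/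
def RSet.initialRow (S : RSet r) (γ : Fin r → ℤ) (i : Fin r) : List (VTree LeafIndex) :=
  (mergedParts .mu .lamLeft (S.mu i) (S.lam i)).reverse.map
      (fun x => VTree.leaf x.1 (x.2 : ℤ) 0) ++
    (mergedParts .nu .lamRight (S.nu i) (S.lam (i + 1))).map
      (fun x => VTree.leaf x.1 (-(x.2 : ℤ)) ((γ i + 2) * (x.2 : ℤ)))

/-- A combined forest (not necessarily connected), given by an `r`-tuple `(F₁, …, F_r)` with
`Fᵢ ∈ Graph_{γᵢ+2}(μⁱ ∪ λⁱ, νⁱ ∪ λⁱ⁺¹)`. -/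
structure CombinedForest (γ : Fin r → ℤ) (S : RSet r) where
  forest : Fin r → List (VTree LeafIndex)
  generated : ∀ i, Generates (S.initialRow γ i) (forest i)

/-- The bridges of a combined forest: one for each part of each `λⁱ`. -/
abbrev RSet.Bridge (S : RSet r) : Type := Σ i : Fin r, Fin (S.lam i).length

/-- The label `h(b)` of a bridge: the part of `λⁱ` it belongs to. -/
def RSet.bridgeLabel (S : RSet r) (b : S.Bridge) : ℕ := (S.lam b.1).parts.get b.2

namespace CombinedForest

variable {γ : Fin r → ℤ} {S : RSet r}

/-- The vertices of the graph `W`: all the vertices of all the VEV trees. -/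
abbrev Vertex (W : CombinedForest γ S) : Type :=
  Σ i : Fin r, Σ k : Fin (W.forest i).length, ((W.forest i).get k).Vertex

/-- The edges of the graph `W`: all the edges of all the VEV trees, and the bridges. -/
abbrev Edge (W : CombinedForest γ S) : Type :=
  (Σ i : Fin r, Σ k : Fin (W.forest i).length, ((W.forest i).get k).Edge) ⊕ S.Bridge

/-- `W.IsLeaf i x v`: the vertex `v` is the leaf of `Fᵢ` with leaf index `x`. -/
def IsLeaf (W : CombinedForest γ S) (i : Fin r) (x : LeafIndex) (v : W.Vertex) : Prop :=
  v.1 = i ∧ ((W.forest v.1).get v.2.1).IsLeafAt x v.2.2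

/-- `W.IsLink e u v`: the edge `e` joins `u` and `v`. The bridge of the `j`-th part of `λⁱ`
joins the left leaf of `Fᵢ` and the right leaf of `Fᵢ₋₁` that come from this part. -/
def IsLink (W : CombinedForest γ S) : W.Edge → W.Vertex → W.Vertex → Prop
  | Sum.inl ⟨i, k, e⟩, u, v =>
      u = ⟨i, k, ((W.forest i).get k).upper e⟩ ∧ v = ⟨i, k, ((W.forest i).get k).lower e⟩
  | Sum.inr ⟨i, j⟩, u, v =>
      W.IsLeaf i (.lamLeft j) u ∧ W.IsLeaf (i - 1) (.lamRight j) v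

/-- `W` is connected as a graph (in particular not empty). -/
def Connected (W : CombinedForest γ S) : Prop :=
  (SimpleGraph.fromRel fun u v : W.Vertex => ∃ e : W.Edge, W.IsLink e u v).Connected

/-- The cycle rank `β(W) = #E - #V + 1` of a connected graph `W`. -/
def cycleRank (W : CombinedForest γ S) : ℤ :=
  (Fintype.card W.Edge : ℤ) - (Fintype.card W.Vertex : ℤ) + 1

end CombinedForest

end

/-! ### Amplitudes -/

/-- The `q`-number `[k] = q^{k/2} - q^{-k/2}`. The variable of the field of rational functions is
`q^{1/2}`. -/
noncomputable def qnum (k : ℤ) : RatFunc ℚ := RatFunc.X ^ k - RatFunc.X ^ (-k)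

/-- `t_k = [k]²`. -/
noncomputable def tvar (k : ℤ) : RatFunc ℚ := qnum k ^ 2

/-- The product of the `[ζ_v]` over the vertices `v ∈ V₂(T)`, where
`ζ_v = c_{L(v)} n_{R(v)} - n_{L(v)} c_{R(v)}`. -/
noncomputable def VTree.zetaProd {ι : Type} : VTree ι → RatFunc ℚ
  | .leaf _ _ _ => 1
  | .node L R => qnum (L.c * R.n - L.n * R.c) * (L.zetaProd * R.zetaProd)

/-- The amplitude `𝒜(T)` of a VEV tree: `∏ [ζ_v] / [n_root]` if `n_root ≠ 0`, and
`c_{L(root)} ∏_{v ≠ root} [ζ_v]` if `n_root = 0`. (A VEV tree of a combined forest is never a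
single leaf.) -/
noncomputable def VTree.ampA {ι : Type} : VTree ι → RatFunc ℚ
  | .leaf _ _ n => 1 / qnum n
  | .node L R =>
      if L.n + R.n ≠ 0 then (VTree.node L R).zetaProd / qnum (L.n + R.n)
      else (L.c : RatFunc ℚ) * (L.zetaProd * R.zetaProd)

/-- The product `[μ][ν]` for `T ∈ Graph_a(μ, ν)`: the product of `[|c_v|]` over the leaves `v`. -/
noncomputable def VTree.leafProd {ι : Type} : VTree ι → RatFunc ℚ
  | .leaf _ c _ => qnum |c|
  | .node L R => L.leafProd * R.leafProd

/-- The amplitude `ℬ(T) = 𝒜(T) / ([μ][ν])`. -/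
noncomputable def VTree.ampB {ι : Type} (T : VTree ι) : RatFunc ℚ := T.ampA / T.leafProd

/-- The combined amplitude
`ℋ(W) = (-1)^{l(μ) + l(ν) + γ·d} ∏_T ℬ(T) ∏_b [h(b)]²`. -/
noncomputable def CombinedForest.ampH {r : ℕ} [NeZero r] {γ : Fin r → ℤ} {S : RSet r}
    (W : CombinedForest γ S) : RatFunc ℚ :=
  (-1) ^ ((∑ i, ((S.mu i).length : ℤ)) + (∑ i, ((S.nu i).length : ℤ)) +
      ∑ i, γ i * (S.degree i : ℤ)) *
    (∏ i, ((W.forest i).map VTree.ampB).prod) *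
    ∏ b : S.Bridge, qnum (S.bridgeLabel b) ^ 2

/-- The subring `ℤ[t]` of the field of rational functions, where `t = [1]²`. -/
noncomputable def Zt : Subalgebra ℤ (RatFunc ℚ) := Algebra.adjoin ℤ {tvar 1}

end TopString

/-!
The amplitude `ℋ(W)` is, up to an integer factor, a quotient `∏ [a] / ∏ [b]`. Since `X ^ m - 1` is
the product of the cyclotomic polynomials `Φ_e` with `e ∣ m`, such a quotient is a Laurent polynomial
with integral coefficients as soon as, for each `e`, at least as many `a` as `b` are divisible by
`e`. If moreover the number and the sum of all the `a` and `b` are even, it is invariant under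
`q^{1/2} ↦ q^{-1/2}` and `q^{1/2} ↦ -q^{1/2}`, hence a polynomial in `t = q - 2 + q⁻¹`. This is
`prod_qnum_div_mem_Zt`.

Fix `e`. For a VEV tree `T`, the first label of a leaf divides the second. An induction over subtrees
(`VTree.leafCount_le`) compares the number of `ζ_v` divisible by `e` with the number of such leaves:
if `e` does not divide all leaves of `T`, then `ℬ(T)` has no pole at `Φ_e`, and otherwise the pole
has order at most two (`VTree.countP_denom_le_add_two`). Parities are controlled by
`ζ_v ≡ c_v n_v - c_{L(v)} n_{L(v)} - c_{R(v)} n_{R(v)}` modulo two, which telescopes.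

Now contract each VEV tree of `W` to a point. The result is a connected multigraph whose edges are
the bridges, with the same cycle rank `β`. Let `D` be the set of trees all of whose leaves are
divisible by `e`. A bridge with an end in `D` contributes `[h(b)] ^ 2` with `e ∣ h(b)`. If `e` does
not divide the gcd `k`, then `D` is a proper subset of the vertices, and it has at most as many
elements as there are bridges with an end in `D` (`card_le_card_incident`), so the zeros compensate
the poles. If `e ∣ k`, all bridges contribute, and the order of the pole is at most
`2 (#trees - #bridges) = 2 - 2 β`; for `β = 0` this pole is removed by `t_k`.
-/

/-! ### Products of `q`-numbers and the ring `ℤ[t]` -/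

namespace TopString

lemma qnum_neg (k : ℤ) : qnum (-k) = -qnum k := by
  simp [qnum]

lemma qnum_zero : qnum 0 = 0 := by simp [qnum]

/-- Since `[-k] = -[k]`, passing to absolute values changes a product of `[k]` by a sign only. -/
lemma prod_map_qnum_natAbs (s : Multiset ℤ) :
    ∃ ε : ℤ, ε * ε = 1 ∧ (s.map qnum).prod = ε * (s.map fun k : ℤ => qnum (k.natAbs : ℤ)).prod := by
  induction s using Multiset.induction with
  | empty => exact ⟨1, by simp⟩
  | cons k s ih =>
    obtain ⟨ε, hε, h⟩ := ih
    simp only [Multiset.map_cons, Multiset.prod_cons]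
    rw [h]
    obtain hk | hk := Int.natAbs_eq k
    · exact ⟨ε, hε, by rw [← hk]; ring⟩
    · refine ⟨-ε, by simpa using hε, ?_⟩
      nth_rewrite 1 [hk]
      rw [qnum_neg]; push_cast; ring

lemma prod_map_qnum_sum {I : Type*} (s : Finset I) (f : I → Multiset ℤ) :
    ((∑ x ∈ s, f x).map qnum).prod = ∏ x ∈ s, ((f x).map qnum).prod := by
  rw [← Multiset.coe_mapAddMonoidHom, map_sum, Multiset.prod_sum]

lemma countP_sum {I : Type*} (s : Finset I) (f : I → Multiset ℤ) (p : ℤ → Prop)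
    [DecidablePred p] : (∑ x ∈ s, f x).countP p = ∑ x ∈ s, (f x).countP p := by
  rw [← Multiset.coe_countPAddMonoidHom, map_sum]

lemma qnum_natCast (n : ℕ) :
    qnum n = (RatFunc.X : RatFunc ℚ) ^ (-(n : ℤ)) *
      Polynomial.aeval ((RatFunc.X : RatFunc ℚ) ^ 2) (Polynomial.X ^ n - 1 : Polynomial ℤ) := by
  have hX : (RatFunc.X : RatFunc ℚ) ≠ 0 := RatFunc.X_ne_zero
  simp only [qnum, map_sub, map_pow, Polynomial.aeval_X, map_one, zpow_neg, zpow_natCast]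
  field_simp
  ring

/-- The product of the polynomials `X ^ m - 1` over a multiset of exponents `m`. -/
noncomputable def prodXPowSubOne (s : Multiset ℕ) : Polynomial ℤ :=
  (s.map fun m => (Polynomial.X ^ m - 1 : Polynomial ℤ)).prod

lemma prod_map_qnum_natCast (s : Multiset ℕ) :
    (s.map fun m : ℕ => qnum (m : ℤ)).prod = (RatFunc.X : RatFunc ℚ) ^ (-(s.sum : ℤ)) *
      Polynomial.aeval ((RatFunc.X : RatFunc ℚ) ^ 2) (prodXPowSubOne s) := by
  have hX : (RatFunc.X : RatFunc ℚ) ≠ 0 := RatFunc.X_ne_zero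
  induction s using Multiset.induction with
  | empty => simp [prodXPowSubOne]
  | cons k s ih =>
    simp only [prodXPowSubOne, Multiset.map_cons, Multiset.prod_cons, Multiset.sum_cons] at ih ⊢
    rw [ih, qnum_natCast, map_mul, Nat.cast_add, neg_add, zpow_add₀ hX]
    ring

/-- The exponent of the `e`-th cyclotomic polynomial in `∏ (X ^ m - 1)` is the number of `m`
divisible by `e`. The bound `M` only makes the range of `e` finite. -/
lemma prodXPowSubOne_eq_prod_cyclotomic (M : ℕ) (s : Multiset ℕ)
    (hs : ∀ m ∈ s, 0 < m ∧ m < M) :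
    prodXPowSubOne s = ∏ e ∈ (Finset.range M).filter (0 < ·),
      Polynomial.cyclotomic e ℤ ^ s.countP (e ∣ ·) := by
  induction s using Multiset.induction with
  | empty => simp [prodXPowSubOne]
  | cons k s ih =>
    have hk := hs k (Multiset.mem_cons_self _ _)
    have ih := ih fun m hm => hs m (Multiset.mem_cons_of_mem hm)
    simp only [prodXPowSubOne, Multiset.map_cons, Multiset.prod_cons] at ih ⊢
    simp only [Multiset.countP_cons, pow_add, Finset.prod_mul_distrib]
    rw [ih, mul_comm, ← Polynomial.prod_cyclotomic_eq_X_pow_sub_one hk.1]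
    congr 1
    rw [show k.divisors = ((Finset.range M).filter (0 < ·)).filter (· ∣ k) by
      ext e
      simp only [Nat.mem_divisors, Finset.mem_filter, Finset.mem_range]
      constructor
      · rintro ⟨h, -⟩
        have := Nat.le_of_dvd hk.1 h
        exact ⟨⟨by omega, Nat.pos_of_dvd_of_pos h hk.1⟩, h⟩
      · rintro ⟨-, h⟩
        exact ⟨h, by omega⟩]
    rw [Finset.prod_filter]
    refine Finset.prod_congr rfl fun e _ => ?_
    split_ifs <;> simp

lemma prodXPowSubOne_dvd {a b : Multiset ℕ} (ha : 0 ∉ a) (hb : 0 ∉ b)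
    (h : ∀ e, 0 < e → b.countP (e ∣ ·) ≤ a.countP (e ∣ ·)) :
    prodXPowSubOne b ∣ prodXPowSubOne a := by
  have key : ∀ s : Multiset ℕ, 0 ∉ s → s ≤ a + b →
      ∀ m ∈ s, 0 < m ∧ m < (a + b).sum + 1 := by
    intro s hs hle m hm
    refine ⟨Nat.pos_of_ne_zero fun h => hs (h ▸ hm), ?_⟩
    exact Nat.lt_succ_of_le (Multiset.le_sum_of_mem (Multiset.mem_of_le hle hm))
  rw [prodXPowSubOne_eq_prod_cyclotomic _ a (key a ha (Multiset.le_add_right _ _)),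
    prodXPowSubOne_eq_prod_cyclotomic _ b (key b hb (Multiset.le_add_left _ _))]
  refine Finset.prod_dvd_prod_of_dvd _ _ fun e he => pow_dvd_pow _ (h e ?_)
  exact (Finset.mem_filter.1 he).2

lemma natDegree_X_pow_sub_one (m : ℕ) :
    (Polynomial.X ^ m - 1 : Polynomial ℤ).natDegree = m := by
  simpa using Polynomial.natDegree_X_pow_sub_C (R := ℤ) (n := m) (r := 1)

lemma X_pow_sub_one_ne_zero {m : ℕ} (hm : m ≠ 0) : (Polynomial.X ^ m - 1 : Polynomial ℤ) ≠ 0 := by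
  simpa using Polynomial.X_pow_sub_C_ne_zero (R := ℤ) (Nat.pos_of_ne_zero hm) 1

lemma reverse_X_pow_sub_one (m : ℕ) :
    (Polynomial.X ^ m - 1 : Polynomial ℤ).reverse = -(Polynomial.X ^ m - 1) := by
  rw [Polynomial.reverse, natDegree_X_pow_sub_one, Polynomial.reflect_sub,
    Polynomial.reflect_one, Polynomial.reflect_monomial]
  simp

lemma prodXPowSubOne_ne_zero {s : Multiset ℕ} (hs : 0 ∉ s) : prodXPowSubOne s ≠ 0 := by
  refine Multiset.prod_ne_zero fun h0 => ?_
  obtain ⟨m, hm, h⟩ := Multiset.mem_map.1 h0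
  exact X_pow_sub_one_ne_zero (fun h => hs (h ▸ hm)) h

lemma natDegree_prodXPowSubOne {s : Multiset ℕ} (hs : 0 ∉ s) :
    (prodXPowSubOne s).natDegree = s.sum := by
  induction s using Multiset.induction with
  | empty => simp [prodXPowSubOne]
  | cons k s ih =>
    have h0 : 0 ∉ s := fun h => hs (Multiset.mem_cons_of_mem h)
    have hk : k ≠ 0 := fun h => hs (h ▸ Multiset.mem_cons_self _ _)
    have hne := prodXPowSubOne_ne_zero h0
    have ih := ih h0
    simp only [prodXPowSubOne, Multiset.map_cons, Multiset.prod_cons, Multiset.sum_cons] at *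
    rw [Polynomial.natDegree_mul (X_pow_sub_one_ne_zero hk) hne, ih, natDegree_X_pow_sub_one]

lemma reverse_prodXPowSubOne {s : Multiset ℕ} (hs : 0 ∉ s) :
    (prodXPowSubOne s).reverse = (-1) ^ s.card * prodXPowSubOne s := by
  induction s using Multiset.induction with
  | empty => simpa [prodXPowSubOne] using Polynomial.reverse_C (1 : ℤ)
  | cons k s ih =>
    have h0 : 0 ∉ s := fun h => hs (Multiset.mem_cons_of_mem h)
    have hk : k ≠ 0 := fun h => hs (h ▸ Multiset.mem_cons_self _ _)
    have ih := ih h0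
    simp only [prodXPowSubOne, Multiset.map_cons, Multiset.prod_cons, Multiset.card_cons] at *
    rw [Polynomial.reverse_mul_of_domain, ih, reverse_X_pow_sub_one]
    ring

lemma pow_add_inv_pow_mem_Zt (j : ℕ) :
    ((RatFunc.X : RatFunc ℚ) ^ 2) ^ j + (((RatFunc.X : RatFunc ℚ) ^ 2)⁻¹) ^ j ∈ Zt := by
  have hX : (RatFunc.X : RatFunc ℚ) ≠ 0 := RatFunc.X_ne_zero
  have h1 : (RatFunc.X : RatFunc ℚ) ^ 2 + ((RatFunc.X : RatFunc ℚ) ^ 2)⁻¹ ∈ Zt := by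
    have ht : tvar 1 + (2 : ℤ) ∈ Zt :=
      add_mem (Algebra.subset_adjoin rfl) (intCast_mem Zt 2)
    convert ht using 1
    simp only [tvar, qnum, zpow_neg, zpow_one]
    push_cast
    field_simp
    ring
  induction j using Nat.strong_induction_on with
  | _ j ih =>
    match j, ih with
    | 0, _ => simpa using add_mem (one_mem Zt) (one_mem Zt)
    | 1, _ => simpa using h1
    | j + 2, ih =>
      have h := sub_mem (mul_mem h1 (ih (j + 1) (by omega))) (ih j (by omega))
      convert h using 1
      have hm : ((RatFunc.X : RatFunc ℚ) ^ 2) * ((RatFunc.X : RatFunc ℚ) ^ 2)⁻¹ = 1 :=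
        mul_inv_cancel₀ (pow_ne_zero 2 hX)
      generalize ((RatFunc.X : RatFunc ℚ) ^ 2)⁻¹ = z at *
      generalize ((RatFunc.X : RatFunc ℚ) ^ 2) = x at *
      linear_combination (-x ^ j - z ^ j) * hm

/-- A palindromic sum of odd length `2 s + 1`, centred at `0`, is a polynomial in `t`. -/
lemma palindrome_sum_mem_Zt (s : ℕ) : ∀ p : ℕ → ℤ, (∀ i ≤ 2 * s, p (2 * s - i) = p i) →
    (((RatFunc.X : RatFunc ℚ) ^ 2)⁻¹) ^ s *
      ∑ i ∈ Finset.range (2 * s + 1), (p i : RatFunc ℚ) * ((RatFunc.X : RatFunc ℚ) ^ 2) ^ i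
        ∈ Zt := by
  have hX : (RatFunc.X : RatFunc ℚ) ≠ 0 := RatFunc.X_ne_zero
  have hm : ((RatFunc.X : RatFunc ℚ) ^ 2)⁻¹ * ((RatFunc.X : RatFunc ℚ) ^ 2) = 1 :=
    inv_mul_cancel₀ (pow_ne_zero 2 hX)
  induction s with
  | zero => intro p _; simp
  | succ s ih =>
    intro p hp
    -- Split off the two outer terms.
    have h1 := ih (fun i => p (i + 1)) fun i hi => by
      have := hp (i + 1) (by omega)
      rw [← this]; congr 1; omega
    have h2 := mul_mem (intCast_mem Zt (p 0)) (pow_add_inv_pow_mem_Zt (s + 1))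
    convert add_mem h1 h2 using 1
    have hend : p (2 * s + 1 + 1) = p 0 := by
      have := hp 0 (by omega)
      rw [← this]; congr 1
    rw [show 2 * (s + 1) + 1 = 2 * s + 1 + 1 + 1 by ring, Finset.sum_range_succ,
      Finset.sum_range_succ', hend]
    generalize ((RatFunc.X : RatFunc ℚ) ^ 2)⁻¹ = z at *
    generalize ((RatFunc.X : RatFunc ℚ) ^ 2) = x at *
    have hS : ∑ i ∈ Finset.range (2 * s + 1), (p (i + 1) : RatFunc ℚ) * x ^ (i + 1) =
        x * ∑ i ∈ Finset.range (2 * s + 1), (p (i + 1) : RatFunc ℚ) * x ^ i := by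
      rw [Finset.mul_sum]; refine Finset.sum_congr rfl fun i _ => by ring
    have hz : z ^ (s + 1) * x ^ (2 * s + 1 + 1) = x ^ (s + 1) := by
      rw [show 2 * s + 1 + 1 = (s + 1) + (s + 1) by ring, pow_add x, ← mul_assoc, ← mul_pow, hm]
      simp
    rw [hS]
    generalize (∑ i ∈ Finset.range (2 * s + 1), (p (i + 1) : RatFunc ℚ) * x ^ i) = S at *
    linear_combination (z ^ s * S) * hm + (p 0 : RatFunc ℚ) * hz

/-- The quotient `∏ (X ^ a - 1) / ∏ (X ^ b - 1)` is an integral polynomial `P` by the count of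
cyclotomic factors; the two parity conditions say that `P` is palindromic (rather than
antipalindromic) and of even degree. -/
lemma prod_qnum_div_mem_Zt_of_nat {a b : Multiset ℕ}
    (hcard : Even (a.card + b.card)) (hsum : Even (a.sum + b.sum))
    (h : ∀ e, 0 < e → b.countP (e ∣ ·) ≤ a.countP (e ∣ ·)) :
    (a.map fun m : ℕ => qnum (m : ℤ)).prod / (b.map fun m : ℕ => qnum (m : ℤ)).prod ∈ Zt := by
  have hX : (RatFunc.X : RatFunc ℚ) ≠ 0 := RatFunc.X_ne_zero
  have hzero : ∀ s : Multiset ℕ, 0 ∈ s → (s.map fun m : ℕ => qnum (m : ℤ)).prod = 0 := fun s hs =>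
    Multiset.prod_eq_zero (Multiset.mem_map.2 ⟨0, hs, by simp [qnum_zero]⟩)
  -- If `[0]` occurs in the numerator or in the denominator, the quotient is `0`.
  by_cases ha : 0 ∈ a
  · rw [hzero a ha, zero_div]; exact zero_mem _
  by_cases hb : 0 ∈ b
  · rw [hzero b hb, div_zero]; exact zero_mem _
  by_cases hden : (b.map fun m : ℕ => qnum (m : ℤ)).prod = 0
  · rw [hden, div_zero]; exact zero_mem _
  obtain ⟨P, hP⟩ := prodXPowSubOne_dvd ha hb h
  have hbne := prodXPowSubOne_ne_zero hb
  have hPne : P ≠ 0 := by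
    rintro rfl
    exact prodXPowSubOne_ne_zero ha (by simpa using hP)
  have hdeg : a.sum = b.sum + P.natDegree := by
    rw [← natDegree_prodXPowSubOne ha, hP, Polynomial.natDegree_mul hbne hPne,
      natDegree_prodXPowSubOne hb]
  have hrev : P.reverse = P := by
    have h1 := congrArg Polynomial.reverse hP
    rw [Polynomial.reverse_mul_of_domain, reverse_prodXPowSubOne ha, reverse_prodXPowSubOne hb,
      hP] at h1
    have h2 : ((-1) ^ a.card : Polynomial ℤ) = (-1) ^ b.card := by
      have h3 : ((-1) ^ a.card : Polynomial ℤ) * (-1) ^ b.card = 1 := by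
        rw [← pow_add, hcard.neg_one_pow]
      have h4 : ((-1) ^ b.card : Polynomial ℤ) * (-1) ^ b.card = 1 := by
        rw [← pow_add, Even.neg_one_pow ⟨_, rfl⟩]
      calc ((-1) ^ a.card : Polynomial ℤ) = (-1) ^ a.card * ((-1) ^ b.card * (-1) ^ b.card) := by
            rw [h4, mul_one]
        _ = _ := by rw [← mul_assoc, h3, one_mul]
    rw [h2, mul_assoc] at h1
    exact (mul_left_cancel₀ hbne (mul_left_cancel₀ (pow_ne_zero _ (by simp)) h1)).symm
  obtain ⟨s, hs⟩ : ∃ s, P.natDegree = 2 * s := by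
    obtain ⟨u, hu⟩ := hsum
    exact ⟨u - b.sum, by omega⟩
  have hpal := palindrome_sum_mem_Zt s (fun i => P.coeff i) fun i hi => by
    have := Polynomial.coeff_reverse P i
    rw [hrev, Polynomial.revAt_le (by omega), hs] at this
    exact this.symm
  convert hpal using 1
  have hbev : Polynomial.aeval ((RatFunc.X : RatFunc ℚ) ^ 2) (prodXPowSubOne b) ≠ 0 := by
    intro h0
    exact hden (by rw [prod_map_qnum_natCast, h0, mul_zero])
  rw [prod_map_qnum_natCast, prod_map_qnum_natCast, hP, map_mul]
  rw [Polynomial.aeval_eq_sum_range (p := P), hs, hdeg, hs]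
  simp only [Algebra.smul_def, eq_intCast]
  generalize (∑ i ∈ Finset.range (2 * s + 1), (P.coeff i : RatFunc ℚ) *
    ((RatFunc.X : RatFunc ℚ) ^ 2) ^ i) = S
  push_cast
  rw [neg_add, zpow_add₀ hX, show -(2 * (s : ℤ)) = (-2) * s by ring, zpow_mul, zpow_natCast]
  rw [show (RatFunc.X : RatFunc ℚ) ^ (-2 : ℤ) = (RatFunc.X ^ 2)⁻¹ by
    rw [zpow_neg]; norm_cast]
  have := zpow_ne_zero (-(b.sum : ℤ)) hX
  field_simp

/-- The integrality criterion: a quotient of products of `[k]` lies in `ℤ[t]` if no `e` divides more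
entries of the denominator than of the numerator, and if the number and the sum of all the entries
are even. An entry `0` does no harm, as the quotient is then `0` in `RatFunc ℚ`. -/
lemma prod_qnum_div_mem_Zt {a b : Multiset ℤ}
    (hcard : Even (a.card + b.card)) (hsum : Even (a.sum + b.sum))
    (h : ∀ e : ℕ, 0 < e → b.countP ((e : ℤ) ∣ ·) ≤ a.countP ((e : ℤ) ∣ ·)) :
    (a.map qnum).prod / (b.map qnum).prod ∈ Zt := by
  have hpar : ∀ s : Multiset ℤ, Even (((s.map Int.natAbs).sum : ℕ) + s.sum) := by
    intro s
    induction s using Multiset.induction with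
    | empty => simp
    | cons k s ih =>
      simp only [Multiset.map_cons, Multiset.sum_cons]
      have hk : Even ((k.natAbs : ℤ) + k) := by
        rw [Int.even_add, Int.even_coe_nat, Int.natAbs_even]
      rw [Nat.cast_add, add_add_add_comm]
      exact hk.add ih
  have hcount : ∀ (e : ℕ) (s : Multiset ℤ),
      (s.map Int.natAbs).countP (e ∣ ·) = s.countP ((e : ℤ) ∣ ·) := by
    intro e s
    rw [Multiset.countP_map, Multiset.countP_eq_card_filter]
    congr 1
    refine Multiset.filter_congr fun k _ => ?_
    exact Int.natCast_dvd.symm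
  have hnat := prod_qnum_div_mem_Zt_of_nat (a := a.map Int.natAbs) (b := b.map Int.natAbs)
    (by simpa using hcard)
    (by
      have h1 := (hpar a).add ((hpar b).add hsum)
      have h2 : Even ((((a.map Int.natAbs).sum : ℕ) : ℤ) + ((b.map Int.natAbs).sum : ℕ)) := by
        rw [Int.even_add] at h1 hsum ⊢
        simp only [Int.even_add] at h1
        tauto
      exact_mod_cast h2)
    (fun e he => by rw [hcount, hcount]; exact h e he)
  simp only [Multiset.map_map, Function.comp_def] at hnat
  obtain ⟨ε, -, hε⟩ := prod_map_qnum_natAbs a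
  obtain ⟨δ, hδ1, hδ⟩ := prod_map_qnum_natAbs b
  convert mul_mem (mul_mem (intCast_mem Zt ε) (intCast_mem Zt δ)) hnat using 1
  have h1 : (δ : RatFunc ℚ)⁻¹ = δ := inv_eq_of_mul_eq_one_left (by exact_mod_cast hδ1)
  rw [hε, hδ, div_eq_mul_inv, div_eq_mul_inv, mul_inv, h1]
  ring

end TopString

/-! ### Zeros and poles of the amplitude of a tree -/

namespace TopString
namespace VTree

variable {ι : Type}

/-- The leaves `(idx, c, n)` of a tree, from left to right. -/
def leaves : VTree ι → List (ι × ℤ × ℤ)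
  | leaf idx c n => [(idx, c, n)]
  | node L R => L.leaves ++ R.leaves

/-- The numbers `ζ_v` of the non-leaf vertices of a tree. -/
def zetas : VTree ι → List ℤ
  | leaf _ _ _ => []
  | node L R => (L.c * R.n - L.n * R.c) :: (L.zetas ++ R.zetas)

/-- The entries `a` of the factors `[a]` in the numerator of `ℬ(T)`, for `T` not a leaf. The value
on leaves is arbitrary. -/
def numer : VTree ι → List ℤ
  | leaf _ _ _ => []
  | node L R => if L.n + R.n ≠ 0 then (node L R).zetas else L.zetas ++ R.zetas

/-- The entries `b` of the factors `[b]` in the denominator of `ℬ(T)`, for `T` not a leaf. -/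
def denom (T : VTree ι) : List ℤ :=
  (if T.n ≠ 0 then [T.n] else []) ++ T.leaves.map fun l => |l.2.1|

/-- The integer factor of `ℬ(T)`, for `T` not a leaf. It differs from `1` only if the
second label of the root is `0`. The value on leaves is arbitrary. -/
def scalar : VTree ι → ℤ
  | leaf _ _ _ => 1
  | node L R => if L.n + R.n ≠ 0 then 1 else L.c

lemma zetaProd_eq (T : VTree ι) : T.zetaProd = (T.zetas.map qnum).prod := by
  induction T with
  | leaf => simp [zetaProd, zetas]
  | node L R hL hR => simp [zetaProd, zetas, hL, hR]

lemma leafProd_eq (T : VTree ι) :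
    T.leafProd = ((T.leaves.map fun l => |l.2.1|).map qnum).prod := by
  induction T with
  | leaf => simp [leafProd, leaves]
  | node L R hL hR => simp [leafProd, leaves, hL, hR]

lemma ampB_node (L R : VTree ι) :
    (node L R).ampB = ((node L R).scalar : RatFunc ℚ) *
      (((node L R).numer.map qnum).prod / ((node L R).denom.map qnum).prod) := by
  have hn : (node L R).n = L.n + R.n := rfl
  by_cases h : L.n + R.n = 0
  · simp [ampB, ampA, scalar, numer, denom, hn, h, zetaProd_eq, leafProd_eq, mul_div_assoc]
  · simp [ampB, ampA, scalar, numer, denom, hn, h, zetaProd_eq, leafProd_eq, div_div]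

lemma length_leaves (T : VTree ι) : T.leaves.length = T.zetas.length + 1 := by
  induction T with
  | leaf => simp [leaves, zetas]
  | node L R hL hR => simp [leaves, zetas, hL, hR]; omega

lemma dvd_c {e : ℤ} (T : VTree ι) (hD : ∀ l ∈ T.leaves, e ∣ l.2.1) : e ∣ T.c := by
  induction T with
  | leaf => simpa [leaves, c] using hD
  | node L R hL hR =>
    simp only [leaves, List.mem_append] at hD
    exact dvd_add (hL fun l hl => hD l (.inl hl)) (hR fun l hl => hD l (.inr hl))

lemma dvd_n {e : ℤ} (T : VTree ι) (hcn : ∀ l ∈ T.leaves, l.2.1 ∣ l.2.2)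
    (hD : ∀ l ∈ T.leaves, e ∣ l.2.1) : e ∣ T.n := by
  induction T with
  | leaf =>
    simp only [leaves, List.mem_singleton, forall_eq] at hD hcn
    exact hD.trans hcn
  | node L R hL hR =>
    simp only [leaves, List.mem_append] at hD hcn
    exact dvd_add (hL (fun l hl => hcn l (.inl hl)) fun l hl => hD l (.inl hl))
      (hR (fun l hl => hcn l (.inr hl)) fun l hl => hD l (.inr hl))

lemma dvd_zetas {e : ℤ} (T : VTree ι) (hcn : ∀ l ∈ T.leaves, l.2.1 ∣ l.2.2)
    (hD : ∀ l ∈ T.leaves, e ∣ l.2.1) : ∀ z ∈ T.zetas, e ∣ z := by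
  induction T with
  | leaf => simp [zetas]
  | node L R hL hR =>
    simp only [leaves, List.mem_append] at hD hcn
    have hDL : ∀ l ∈ L.leaves, e ∣ l.2.1 := fun l hl => hD l (.inl hl)
    have hDR : ∀ l ∈ R.leaves, e ∣ l.2.1 := fun l hl => hD l (.inr hl)
    intro z hz
    simp only [zetas, List.mem_cons, List.mem_append] at hz
    rcases hz with rfl | hz | hz
    · exact dvd_sub ((dvd_c L hDL).mul_right _) ((dvd_c R hDR).mul_left _)
    · exact hL (fun l hl => hcn l (.inl hl)) hDL z hz
    · exact hR (fun l hl => hcn l (.inr hl)) hDR z hz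

/-- The number of `ζ_v` which are divisible by `e`. -/
def zetaCount (e : ℤ) (T : VTree ι) : ℕ := T.zetas.countP (e ∣ ·)

/-- The number of leaves whose first label is divisible by `e`. -/
def leafCount (e : ℤ) (T : VTree ι) : ℕ := T.leaves.countP (e ∣ ·.2.1)

/-- When all leaves are divisible by `e`, so are all the `ζ_v`, and there is one leaf more than
there are non-leaf vertices. -/
lemma leafCount_eq {e : ℤ} (T : VTree ι) (hcn : ∀ l ∈ T.leaves, l.2.1 ∣ l.2.2)
    (hD : ∀ l ∈ T.leaves, e ∣ l.2.1) : T.leafCount e = T.zetaCount e + 1 := by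
  have h1 : T.leafCount e = T.leaves.length :=
    List.countP_eq_length.2 fun l hl => by simpa using hD l hl
  have h2 : T.zetaCount e = T.zetas.length :=
    List.countP_eq_length.2 fun z hz => by simpa using T.dvd_zetas hcn hD z hz
  rw [h1, h2, length_leaves]

lemma zetaCount_node (e : ℤ) (L R : VTree ι) : (node L R).zetaCount e =
    L.zetaCount e + R.zetaCount e + if e ∣ L.c * R.n - L.n * R.c then 1 else 0 := by
  simp [zetaCount, zetas, List.countP_cons]

lemma leafCount_node (e : ℤ) (L R : VTree ι) :
    (node L R).leafCount e = L.leafCount e + R.leafCount e := by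
  simp [leafCount, leaves]

/-- The local estimate. When only some leaves are divisible by `e`, the vertices with `e ∣ ζ_v` are
at least as many as the leaves divisible by `e`, and exceed them when `e` divides the label of the
root, since then `e ∣ ζ` holds at the root for free. -/
lemma leafCount_le {e : ℤ} (T : VTree ι) (hcn : ∀ l ∈ T.leaves, l.2.1 ∣ l.2.2)
    (hD : ¬ ∀ l ∈ T.leaves, e ∣ l.2.1) :
    T.leafCount e ≤ T.zetaCount e ∧
      (e ∣ T.c → e ∣ T.n → T.leafCount e + 1 ≤ T.zetaCount e) := by
  induction T with
  | leaf idx c n =>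
    simp only [leaves, List.mem_singleton, forall_eq] at hD
    refine ⟨?_, fun h => absurd h hD⟩
    simp [leafCount, leaves, hD]
  | node L R hL hR =>
    simp only [leaves, List.mem_append] at hD hcn
    have hcnL : ∀ l ∈ L.leaves, l.2.1 ∣ l.2.2 := fun l hl => hcn l (.inl hl)
    have hcnR : ∀ l ∈ R.leaves, l.2.1 ∣ l.2.2 := fun l hl => hcn l (.inr hl)
    rw [zetaCount_node, leafCount_node]
    have hfree : e ∣ (node L R).c → e ∣ (node L R).n → e ∣ L.c * R.n - L.n * R.c := by
      intro h1 h2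
      have : L.c * R.n - L.n * R.c = L.c * (L.n + R.n) - L.n * (L.c + R.c) := by ring
      rw [this]
      exact dvd_sub (h2.mul_left _) (h1.mul_left _)
    by_cases hDL : ∀ l ∈ L.leaves, e ∣ l.2.1
    · have hDR : ¬ ∀ l ∈ R.leaves, e ∣ l.2.1 := fun h =>
        hD fun l hl => hl.elim (hDL l) (h l)
      have h1 := L.leafCount_eq hcnL hDL
      obtain ⟨h2, h3⟩ := hR hcnR hDR
      have hc := L.dvd_c hDL
      have hn := L.dvd_n hcnL hDL
      have hz : e ∣ L.c * R.n - L.n * R.c := dvd_sub (hc.mul_right _) (hn.mul_right _)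
      rw [if_pos hz]
      refine ⟨by omega, fun h4 h5 => ?_⟩
      have := h3 ((dvd_add_right hc).1 h4) ((dvd_add_right hn).1 h5)
      omega
    · obtain ⟨h2, h3⟩ := hL hcnL hDL
      by_cases hDR : ∀ l ∈ R.leaves, e ∣ l.2.1
      · have h1 := R.leafCount_eq hcnR hDR
        have hc := R.dvd_c hDR
        have hn := R.dvd_n hcnR hDR
        have hz : e ∣ L.c * R.n - L.n * R.c := dvd_sub (hn.mul_left _) (hc.mul_left _)
        rw [if_pos hz]
        refine ⟨by omega, fun h4 h5 => ?_⟩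
        have := h3 ((dvd_add_left hc).1 h4) ((dvd_add_left hn).1 h5)
        omega
      · obtain ⟨h4, h5⟩ := hR hcnR hDR
        refine ⟨by omega, fun h6 h7 => ?_⟩
        rw [if_pos (hfree h6 h7)]
        omega

lemma countP_denom (e : ℤ) (T : VTree ι) : T.denom.countP (e ∣ ·) =
    (if T.n ≠ 0 ∧ e ∣ T.n then 1 else 0) + T.leafCount e := by
  rw [denom, List.countP_append, List.countP_map, leafCount]
  congr 1
  · by_cases h : T.n = 0 <;> simp [h, List.countP_cons]
  · simp [Function.comp_def]

lemma countP_numer_node (e : ℤ) (L R : VTree ι) : (node L R).numer.countP (e ∣ ·) =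
    (if L.n + R.n ≠ 0 ∧ e ∣ L.c * R.n - L.n * R.c then 1 else 0) +
      (L.zetaCount e + R.zetaCount e) := by
  by_cases h : L.n + R.n = 0
  · simp [numer, h, zetaCount]
  · simp only [numer, ne_eq, h, not_false_eq_true, if_true, true_and]
    have := zetaCount_node e L R
    rw [zetaCount] at this
    rw [this, add_comm]

/-- With `e` standing for the primitive `e`-th roots of unity as values of `q`, the poles of `ℬ(T)`
there have order at most two, and occur only if `e` divides all leaves. As `c_{L} + c_{R} = 0` at the
root, its factor is `[c_L n_root] / [n_root]`, where `e ∣ n_root` implies `e ∣ c_L n_root`. -/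
lemma countP_denom_le_add_two {e : ℤ} {L R : VTree ι}
    (hcn : ∀ l ∈ (node L R).leaves, l.2.1 ∣ l.2.2) (hc : (node L R).c = 0) :
    (node L R).denom.countP (e ∣ ·) ≤ (node L R).numer.countP (e ∣ ·) + 2 ∧
      ((¬ ∀ l ∈ (node L R).leaves, e ∣ l.2.1) →
        (node L R).denom.countP (e ∣ ·) ≤ (node L R).numer.countP (e ∣ ·)) := by
  have hcRL : R.c = -L.c := by simp only [c] at hc; omega
  rw [countP_denom, countP_numer_node, leafCount_node]
  have hn : (node L R).n = L.n + R.n := rfl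
  have hz : L.c * R.n - L.n * R.c = L.c * (L.n + R.n) := by rw [hcRL]; ring
  rw [hn, hz]
  have hroot : (if L.n + R.n ≠ 0 ∧ e ∣ L.n + R.n then 1 else 0) ≤
      if L.n + R.n ≠ 0 ∧ e ∣ L.c * (L.n + R.n) then 1 else 0 := by
    split_ifs with h1 h2 <;> first | omega | exact absurd ⟨h1.1, h1.2.mul_left _⟩ h2
  simp only [leaves, List.mem_append] at hcn ⊢
  have hcnL : ∀ l ∈ L.leaves, l.2.1 ∣ l.2.2 := fun l hl => hcn l (.inl hl)
  have hcnR : ∀ l ∈ R.leaves, l.2.1 ∣ l.2.2 := fun l hl => hcn l (.inr hl)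
  by_cases hDL : ∀ l ∈ L.leaves, e ∣ l.2.1
  · have h1 := L.leafCount_eq hcnL hDL
    have hLc := L.dvd_c hDL
    have hLn := L.dvd_n hcnL hDL
    by_cases hDR : ∀ l ∈ R.leaves, e ∣ l.2.1
    · have h2 := R.leafCount_eq hcnR hDR
      exact ⟨by omega, fun hD => absurd (fun l hl => hl.elim (hDL l) (hDR l)) hD⟩
    · obtain ⟨h2, h3⟩ := R.leafCount_le hcnR hDR
      refine ⟨by omega, fun _ => ?_⟩
      -- `L` lacks one factor: `R` supplies it if `e ∣ n_root`, and otherwise the root does.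
      by_cases hen : e ∣ L.n + R.n
      · have := h3 (hcRL ▸ (dvd_neg.2 hLc)) ((dvd_add_right hLn).1 hen)
        omega
      · have h0 : L.n + R.n ≠ 0 := fun h => hen (h ▸ dvd_zero e)
        rw [if_neg (by tauto), if_pos ⟨h0, hLc.mul_right _⟩]
        omega
  · obtain ⟨h2, h3⟩ := L.leafCount_le hcnL hDL
    by_cases hDR : ∀ l ∈ R.leaves, e ∣ l.2.1
    · have h1 := R.leafCount_eq hcnR hDR
      have hRc := R.dvd_c hDR
      have hRn := R.dvd_n hcnR hDR
      have hLc : e ∣ L.c := by rw [hcRL] at hRc; exact (dvd_neg.1 hRc)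
      refine ⟨by omega, fun _ => ?_⟩
      by_cases hen : e ∣ L.n + R.n
      · have := h3 hLc ((dvd_add_left hRn).1 hen)
        omega
      · have h0 : L.n + R.n ≠ 0 := fun h => hen (h ▸ dvd_zero e)
        rw [if_neg (by tauto), if_pos ⟨h0, hLc.mul_right _⟩]
        omega
    · obtain ⟨h4, h5⟩ := R.leafCount_le hcnR hDR
      exact ⟨by omega, fun _ => by omega⟩

/-- The invariance of `ℬ(T)` under `q^{1/2} ↦ q^{-1/2}`, in terms of parities. -/
lemma even_length_numer_add_denom (L R : VTree ι) :
    Even ((node L R).numer.length + (node L R).denom.length) := by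
  have hn : (node L R).n = L.n + R.n := rfl
  have hL := L.length_leaves
  have hR := R.length_leaves
  by_cases h : L.n + R.n = 0
  · simp only [numer, denom, hn, h, ne_eq, not_true_eq_false, if_false, leaves,
      List.length_append, List.length_map, List.length_nil]
    exact ⟨L.zetas.length + R.zetas.length + 1, by omega⟩
  · simp only [numer, denom, hn, h, ne_eq, not_false_eq_true, if_true, leaves, zetas,
      List.length_append, List.length_map, List.length_nil, List.length_cons]
    exact ⟨L.zetas.length + R.zetas.length + 2, by omega⟩

/-- Modulo two, `ζ_v = c_v n_v - c_{L(v)} n_{L(v)} - c_{R(v)} n_{R(v)}`, so that the sum of the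
`ζ_v` telescopes. -/
lemma even_sum_zetas (T : VTree ι) (hpar : ∀ l ∈ T.leaves, Even (l.2.1 * l.2.2 + l.2.2)) :
    Even (T.zetas.sum + T.c * T.n + T.n) := by
  induction T with
  | leaf => simpa [leaves, zetas, c, n] using hpar
  | node L R hL hR =>
    simp only [leaves, List.mem_append] at hpar
    have h1 := hL fun l hl => hpar l (.inl hl)
    have h2 := hR fun l hl => hpar l (.inr hl)
    simp only [zetas, c, n, List.sum_cons, List.sum_append]
    refine (congrArg Even ?_).mp ((h1.add h2).add (even_two_mul (L.c * R.n)))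
    ring

lemma even_sum_abs_leaves (T : VTree ι) :
    Even ((T.leaves.map fun l => |l.2.1|).sum + T.c) := by
  induction T with
  | leaf idx c n =>
    simp only [leaves, List.map_cons, List.map_nil, List.sum_cons, List.sum_nil, add_zero, VTree.c]
    rw [Int.even_add, even_abs]
  | node L R hL hR =>
    simp only [leaves, c, List.map_append, List.sum_append]
    rw [add_add_add_comm]
    exact hL.add hR

/-- The invariance of `ℬ(T)` under `q^{1/2} ↦ -q^{1/2}`, in terms of parities. -/
lemma even_sum_numer_add_denom {L R : VTree ι}
    (hpar : ∀ l ∈ (node L R).leaves, Even (l.2.1 * l.2.2 + l.2.2)) (hc : (node L R).c = 0) :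
    Even ((node L R).numer.sum + (node L R).denom.sum) := by
  have h1 := (node L R).even_sum_zetas hpar
  have h2 := (node L R).even_sum_abs_leaves
  rw [hc] at h1 h2
  have hn : (node L R).n = L.n + R.n := rfl
  have hcRL : R.c = -L.c := by simp only [c] at hc; omega
  have hz : L.c * R.n - L.n * R.c = L.c * (L.n + R.n) := by rw [hcRL]; ring
  by_cases h : L.n + R.n = 0
  · rw [hn, h, zetas, List.sum_cons, hz, h] at h1
    simp only [numer, denom, hn, h, ne_eq, not_true_eq_false, if_false, List.nil_append]
    simpa using h1.add h2
  · simp only [numer, denom, hn, h, ne_eq, not_false_eq_true, if_true,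
      List.cons_append, List.nil_append, List.sum_cons]
    rw [hn] at h1
    refine (congrArg Even ?_).mp (h1.add h2)
    ring

end VTree
end TopString

/-! ### Leaves and roots of generated forests -/

namespace TopString

namespace VTree

variable {ι : Type}

lemma IsLeafAt.exists_mem_leaves {x : ι} {T : VTree ι} {v : T.Vertex} (h : T.IsLeafAt x v) :
    ∃ l ∈ T.leaves, l.1 = x := by
  induction T with
  | leaf idx c n => exact ⟨(idx, c, n), by simp [leaves], h⟩
  | node L R hL hR =>
    match v, h with
    | some (Sum.inl v), h =>
      obtain ⟨l, hl, hx⟩ := hL (v := v) h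
      exact ⟨l, List.mem_append_left _ hl, hx⟩
    | some (Sum.inr v), h =>
      obtain ⟨l, hl, hx⟩ := hR (v := v) h
      exact ⟨l, List.mem_append_right _ hl, hx⟩

lemma card_vertex (T : VTree ι) : Fintype.card T.Vertex = Fintype.card T.Edge + 1 := by
  induction T with
  | leaf => rfl
  | node L R hL hR =>
    have h1 : Fintype.card (node L R).Vertex = Fintype.card (Option (L.Vertex ⊕ R.Vertex)) := rfl
    have h2 : Fintype.card (node L R).Edge = Fintype.card (Option L.Edge ⊕ Option R.Edge) := rfl
    rw [h1, h2]
    simp only [Fintype.card_option, Fintype.card_sum]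
    omega

end VTree

namespace Generates

variable {ι : Type} {s F : List (VTree ι)}

/-- Every leaf of the initial row is a leaf of exactly one tree of the forest. -/
lemma leaves_perm (h : Generates s F) :
    (F.flatMap VTree.leaves).Perm (s.flatMap VTree.leaves) := by
  induction h with
  | done => exact List.Perm.refl _
  | vacuum s F T hT h ih =>
    simp only [List.flatMap_cons, List.flatMap_append, List.flatMap_nil, List.append_nil]
    exact (ih.append_left _).trans List.perm_append_comm
  | cross s t F A B hA hB hright h ih =>
    refine ih.trans (List.Perm.flatMap_right _ ?_)
    exact (List.Perm.swap A B t).append_left s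
  | merge s t F A B hA hB hright hne h ih =>
    refine ih.trans ?_
    simp [VTree.leaves]
  | mergeWhite s t F A B hA hB hright heq h ih =>
    simp only [List.flatMap_cons, List.flatMap_append, VTree.leaves] at ih ⊢
    refine (ih.append_left _).trans ?_
    rw [← List.append_assoc, ← List.append_assoc, ← List.append_assoc]
    refine List.Perm.append_right _ ?_
    rw [List.append_assoc _ A.leaves]
    exact List.perm_append_comm

/-- Roots have first label `0`; hence they are not leaves when the leaves of the row have non-zero
first label. -/
lemma root (h : Generates s F) (hs : ∀ T ∈ s, T.c = 0 → ∃ L R, T = .node L R) :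
    ∀ T ∈ F, T.c = 0 ∧ ∃ L R, T = .node L R := by
  induction h with
  | done => simp
  | vacuum s F T hT h ih =>
    intro T' hT'
    rcases List.mem_cons.1 hT' with rfl | hT'
    · exact ⟨hT, hs _ (by simp) hT⟩
    · exact ih (fun T hT => hs T (by simp [hT])) T' hT'
  | cross s t F A B hA hB hright h ih =>
    refine ih fun T hT => hs T ?_
    simp only [List.mem_append, List.mem_cons] at hT ⊢
    tauto
  | merge s t F A B hA hB hright hne h ih =>
    refine ih fun T hT => ?_
    simp only [List.mem_append, List.mem_cons] at hT
    rcases hT with hT | rfl | hT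
    · exact hs T (by simp [hT])
    · exact fun _ => ⟨A, B, rfl⟩
    · exact hs T (by simp [hT])
  | mergeWhite s t F A B hA hB hright heq h ih =>
    intro T hT
    rcases List.mem_cons.1 hT with rfl | hT
    · exact ⟨(Prod.mk.inj heq).1, A, B, rfl⟩
    · refine ih (fun T hT => hs T ?_) T hT
      simp only [List.mem_append, List.mem_cons] at hT ⊢
      tauto

end Generates

lemma Ptn.pos_of_mem_parts {p : Ptn} {m : ℕ} (hm : m ∈ p.parts) : 0 < m :=
  p.2.parts_pos (by simpa [Ptn.parts] using hm)

lemma mergedParts_perm (f g : ℕ → LeafIndex) (p p' : Ptn) :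
    (mergedParts f g p p').Perm
      (p.parts.mapIdx (fun j x => (f j, x)) ++ p'.parts.mapIdx (fun j x => (g j, x))) :=
  List.perm_insertionSort _ _

lemma mem_mergedParts {f g : ℕ → LeafIndex} {p p' : Ptn} {x : LeafIndex × ℕ} :
    x ∈ mergedParts f g p p' ↔
      (∃ (j : ℕ) (h : j < p.parts.length), (f j, p.parts[j]) = x) ∨
        ∃ (j : ℕ) (h : j < p'.parts.length), (g j, p'.parts[j]) = x := by
  rw [(mergedParts_perm f g p p').mem_iff, List.mem_append, List.mem_mapIdx, List.mem_mapIdx]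

lemma pos_of_mem_mergedParts {f g : ℕ → LeafIndex} {p p' : Ptn} {x : LeafIndex × ℕ}
    (hx : x ∈ mergedParts f g p p') : 0 < x.2 := by
  rcases mem_mergedParts.1 hx with ⟨j, h, rfl⟩ | ⟨j, h, rfl⟩ <;>
    exact Ptn.pos_of_mem_parts (List.getElem_mem h)

lemma nodup_map_fst_mergedParts {f g : ℕ → LeafIndex} (hf : f.Injective) (hg : g.Injective)
    (hfg : ∀ i j, f i ≠ g j) (p p' : Ptn) : ((mergedParts f g p p').map Prod.fst).Nodup := by
  have key : ∀ (f : ℕ → LeafIndex) (l : List ℕ), f.Injective →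
      ((l.mapIdx fun j x => (f j, x)).map Prod.fst).Nodup := by
    intro f l hf
    rw [List.mapIdx_eq_ofFn, List.map_ofFn, List.nodup_ofFn]
    exact fun a b hab => Fin.ext (hf hab)
  rw [((mergedParts_perm f g p p').map Prod.fst).nodup_iff, List.map_append,
    List.nodup_append]
  refine ⟨key f _ hf, key g _ hg, ?_⟩
  intro a ha b hb
  obtain ⟨x, hx, rfl⟩ := List.mem_map.1 ha
  obtain ⟨y, hy, rfl⟩ := List.mem_map.1 hb
  obtain ⟨i, _, rfl⟩ := List.mem_mapIdx.1 hx
  obtain ⟨j, _, rfl⟩ := List.mem_mapIdx.1 hy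
  exact hfg i j

section

variable {r : ℕ} [NeZero r]

/-- The leaves of the initial row. -/
lemma RSet.leaves_initialRow (S : RSet r) (γ : Fin r → ℤ) (i : Fin r) :
    (S.initialRow γ i).flatMap VTree.leaves =
      (mergedParts .mu .lamLeft (S.mu i) (S.lam i)).reverse.map
          (fun x => (x.1, ((x.2 : ℤ), (0 : ℤ)))) ++
        (mergedParts .nu .lamRight (S.nu i) (S.lam (i + 1))).map
          (fun x => (x.1, (-(x.2 : ℤ), (γ i + 2) * (x.2 : ℤ)))) := by
  simp only [RSet.initialRow, VTree.leaves, List.flatMap_append, List.flatMap_map,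
    ← List.map_eq_flatMap]

namespace CombinedForest

variable {γ : Fin r → ℤ} {S : RSet r} (W : CombinedForest γ S)

lemma mem_leaves_iff (i : Fin r) (l : LeafIndex × ℤ × ℤ) :
    (∃ T ∈ W.forest i, l ∈ T.leaves) ↔
      (∃ x ∈ mergedParts .mu .lamLeft (S.mu i) (S.lam i), l = (x.1, (x.2 : ℤ), 0)) ∨
        ∃ x ∈ mergedParts .nu .lamRight (S.nu i) (S.lam (i + 1)),
          l = (x.1, -(x.2 : ℤ), (γ i + 2) * (x.2 : ℤ)) := by
  rw [← List.mem_flatMap, (W.generated i).leaves_perm.mem_iff, RSet.leaves_initialRow,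
    List.mem_append, List.mem_map, List.mem_map]
  simp only [List.mem_reverse, eq_comm]

/-- The two properties of leaf labels `(c, n)` on which the estimates depend: `c ∣ n`, and
`c n ≡ n` modulo two. -/
lemma leaf_label {i : Fin r} {T : VTree LeafIndex} (hT : T ∈ W.forest i)
    {l : LeafIndex × ℤ × ℤ} (hl : l ∈ T.leaves) :
    l.2.1 ∣ l.2.2 ∧ Even (l.2.1 * l.2.2 + l.2.2) := by
  rcases (W.mem_leaves_iff i l).1 ⟨T, hT, hl⟩ with ⟨x, hx, rfl⟩ | ⟨x, hx, rfl⟩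
  · simp
  · refine ⟨⟨-(γ i + 2), by ring⟩, ?_⟩
    have h : Even ((x.2 : ℤ) * (x.2 - 1)) := Int.even_mul_pred_self _
    refine (congrArg Even ?_).mp (h.mul_left (-(γ i + 2)))
    ring

lemma root_forest {i : Fin r} {T : VTree LeafIndex} (hT : T ∈ W.forest i) :
    T.c = 0 ∧ ∃ L R, T = .node L R := by
  refine (W.generated i).root (fun T hT hc => ?_) T hT
  rcases List.mem_append.1 hT with h | h
  · obtain ⟨x, hx, rfl⟩ := List.mem_map.1 h
    have := pos_of_mem_mergedParts (List.mem_reverse.1 hx)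
    simp only [VTree.c] at hc
    omega
  · obtain ⟨x, hx, rfl⟩ := List.mem_map.1 h
    have := pos_of_mem_mergedParts hx
    simp only [VTree.c] at hc
    omega

lemma leaf_lamLeft {i : Fin r} {T : VTree LeafIndex} (hT : T ∈ W.forest i)
    {l : LeafIndex × ℤ × ℤ} (hl : l ∈ T.leaves) (j : Fin (S.lam i).length)
    (hlj : l.1 = .lamLeft j) : l.2.1 = ((S.lam i).parts.get j : ℕ) := by
  rcases (W.mem_leaves_iff i l).1 ⟨T, hT, hl⟩ with ⟨x, hx, rfl⟩ | ⟨x, hx, rfl⟩ <;>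
    rcases mem_mergedParts.1 hx with ⟨k, hk, rfl⟩ | ⟨k, hk, rfl⟩ <;>
    simp_all
  rfl

lemma leaf_lamRight {i : Fin r} {T : VTree LeafIndex} (hT : T ∈ W.forest i)
    {l : LeafIndex × ℤ × ℤ} (hl : l ∈ T.leaves) (j : Fin (S.lam (i + 1)).length)
    (hlj : l.1 = .lamRight j) : l.2.1 = -((S.lam (i + 1)).parts.get j : ℕ) := by
  rcases (W.mem_leaves_iff i l).1 ⟨T, hT, hl⟩ with ⟨x, hx, rfl⟩ | ⟨x, hx, rfl⟩ <;>
    rcases mem_mergedParts.1 hx with ⟨k, hk, rfl⟩ | ⟨k, hk, rfl⟩ <;>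
    simp_all
  rfl

/-- Every part of every partition of the `r`-set is, up to sign, the label of a leaf. -/
lemma dvd_gcd {e : ℕ}
    (h : ∀ i, ∀ T ∈ W.forest i, ∀ l ∈ T.leaves, (e : ℤ) ∣ l.2.1) : e ∣ S.gcd := by
  have hleft : ∀ i, ∀ x ∈ mergedParts .mu .lamLeft (S.mu i) (S.lam i), e ∣ x.2 := by
    intro i x hx
    obtain ⟨T, hT, hl⟩ := (W.mem_leaves_iff i _).2 (.inl ⟨x, hx, rfl⟩)
    exact Int.natCast_dvd_natCast.1 (h i T hT _ hl)
  have hright : ∀ i, ∀ x ∈ mergedParts .nu .lamRight (S.nu i) (S.lam (i + 1)), e ∣ x.2 := by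
    intro i x hx
    obtain ⟨T, hT, hl⟩ := (W.mem_leaves_iff i _).2 (.inr ⟨x, hx, rfl⟩)
    exact Int.natCast_dvd_natCast.1 (dvd_neg.1 (h i T hT _ hl))
  have hparts : ∀ (p : Ptn) m, m ∈ p.2.parts → ∃ (j : ℕ) (h : j < p.parts.length),
      p.parts[j] = m := fun p m hm =>
    List.mem_iff_getElem.1 (by simpa [Ptn.parts] using hm)
  refine Finset.dvd_gcd fun i _ => Multiset.dvd_gcd.2 fun m hm => ?_
  simp only [Multiset.mem_add] at hm
  rcases hm with (hm | hm) | hm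
  · obtain ⟨j, hj, rfl⟩ := hparts _ _ hm
    exact hleft i _ (mem_mergedParts.2 (.inl ⟨j, hj, rfl⟩))
  · obtain ⟨j, hj, rfl⟩ := hparts _ _ hm
    exact hright i _ (mem_mergedParts.2 (.inl ⟨j, hj, rfl⟩))
  · obtain ⟨j, hj, rfl⟩ := hparts _ _ hm
    exact hleft i _ (mem_mergedParts.2 (.inr ⟨j, hj, rfl⟩))

/-- No leaf index occurs twice, so that a bridge determines the two trees which it joins. -/
lemma nodup_leafIndices (i : Fin r) :
    ((W.forest i).flatMap fun T => T.leaves.map Prod.fst).Nodup := by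
  rw [← List.map_flatMap, ((W.generated i).leaves_perm.map Prod.fst).nodup_iff,
    RSet.leaves_initialRow, List.map_append, List.map_map, List.map_map, List.nodup_append]
  refine ⟨?_, ?_, ?_⟩
  · rw [List.map_reverse, List.nodup_reverse]
    exact nodup_map_fst_mergedParts (fun a b h => by simpa using h) (fun a b h => by simpa using h)
      (by simp) _ _
  · exact nodup_map_fst_mergedParts (fun a b h => by simpa using h) (fun a b h => by simpa using h)
      (by simp) _ _
  · intro a ha b hb
    obtain ⟨x, hx, rfl⟩ := List.mem_map.1 ha
    obtain ⟨y, hy, rfl⟩ := List.mem_map.1 hb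
    rcases mem_mergedParts.1 (List.mem_reverse.1 hx) with ⟨j, hj, rfl⟩ | ⟨j, hj, rfl⟩ <;>
      rcases mem_mergedParts.1 hy with ⟨k, hk, rfl⟩ | ⟨k, hk, rfl⟩ <;> simp

/-- The trees of a combined forest. -/
abbrev TreeIdx : Type := Σ i : Fin r, Fin (W.forest i).length

/-- The tree containing a vertex. -/
def treeIdx (v : W.Vertex) : W.TreeIdx := ⟨v.1, v.2.1⟩

/-- The tree with a given index. -/
def tree (x : W.TreeIdx) : VTree LeafIndex := (W.forest x.1).get x.2

lemma tree_mem (x : W.TreeIdx) : W.tree x ∈ W.forest x.1 := List.get_mem _ _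

variable {W}

lemma IsLeaf.treeIdx_eq {i : Fin r} {x : LeafIndex} {u v : W.Vertex}
    (hu : W.IsLeaf i x u) (hv : W.IsLeaf i x v) : W.treeIdx u = W.treeIdx v := by
  obtain ⟨iu, ku, u⟩ := u
  obtain ⟨iv, kv, v⟩ := v
  obtain ⟨rfl, hu⟩ := hu
  obtain ⟨hi, hv⟩ := hv
  dsimp only at hi
  subst hi
  by_contra hne
  have hk : ku ≠ kv := fun h => hne (by simp [treeIdx, h])
  obtain ⟨l, hl, hlx⟩ := hu.exists_mem_leaves
  obtain ⟨l', hl', hlx'⟩ := hv.exists_mem_leaves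
  have hnd := (List.nodup_flatMap.1 (W.nodup_leafIndices iv)).2
  rw [List.pairwise_iff_get] at hnd
  have h1 := List.mem_map.2 ⟨l, hl, hlx⟩
  have h2 := List.mem_map.2 ⟨l', hl', hlx'⟩
  rcases lt_or_gt_of_ne hk with h | h
  · exact hnd _ _ h h1 h2
  · exact hnd _ _ h h2 h1

end CombinedForest

end

end TopString

/-! ### Contracting the trees of a combined forest -/

namespace TopString

/-- In a connected multigraph, a proper set `D` of vertices has at most as many elements as there
are edges with an end in `D`: send each vertex of `D` to the first edge of a shortest path to a
fixed vertex outside `D`. -/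
lemma card_le_card_incident {I B : Type*} [Fintype I] [Fintype B] {G : SimpleGraph I}
    (hG : G.Connected) {link : B → I → I → Prop}
    (hadj : ∀ x y, G.Adj x y → ∃ b, link b x y ∨ link b y x)
    (huniq : ∀ b x y x' y', link b x y → link b x' y' → x = x' ∧ y = y')
    {D : I → Prop} [DecidablePred D] (hD : ∃ x, ¬ D x) {E : B → Prop} [DecidablePred E]
    (hE : ∀ b x y, link b x y → D x ∨ D y → E b) :
    (Finset.univ.filter D).card ≤ (Finset.univ.filter E).card := by
  obtain ⟨x₀, hx₀⟩ := hD
  have hstep : ∀ x, D x → ∃ b y, (link b x y ∨ link b y x) ∧ G.dist y x₀ < G.dist x x₀ := by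
    intro x hx
    obtain ⟨p, hp⟩ := (hG.preconnected x x₀).exists_walk_length_eq_dist
    cases p with
    | nil => exact absurd hx hx₀
    | cons h p =>
      obtain ⟨b, hb⟩ := hadj _ _ h
      refine ⟨b, _, hb, ?_⟩
      rw [← hp, SimpleGraph.Walk.length_cons]
      exact Nat.lt_succ_of_le (SimpleGraph.dist_le p)
  rcases isEmpty_or_nonempty B with hB | hB
  · have hnot : ∀ x, ¬ D x := fun x hx => hB.elim (hstep x hx).choose
    simp [hnot]
  have : Nonempty I := ⟨x₀⟩
  choose! b y hb hdist using hstep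
  refine Finset.card_le_card_of_injOn b (fun x hx => ?_) fun x hx x' hx' hbb => ?_
  · have hx : D x := by simpa using hx
    have : E (b x) := (hb x hx).elim (fun h => hE _ _ _ h (.inl hx)) fun h => hE _ _ _ h (.inr hx)
    simpa using this
  · have hx : D x := by simpa using hx
    have hx' : D x' := by simpa using hx'
    have h1 := hdist x hx
    have h2 := hdist x' hx'
    have hl := hb x hx
    have hl' := hb x' hx'
    rw [← hbb] at hl'
    rcases hl with h | h <;> rcases hl' with h' | h' <;> obtain ⟨h3, h4⟩ := huniq _ _ _ _ _ h h'
    · exact h3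
    · rw [h4] at h1; rw [← h3] at h2; omega
    · rw [h3] at h1; rw [← h4] at h2; omega
    · exact h4

namespace CombinedForest

variable {r : ℕ} [NeZero r] {γ : Fin r → ℤ} {S : RSet r} (W : CombinedForest γ S)

/-- The bridge `b` runs from the tree `x` to the tree `y`. -/
def TreeLink (b : S.Bridge) (x y : W.TreeIdx) : Prop :=
  ∃ u v, W.IsLink (Sum.inr b) u v ∧ W.treeIdx u = x ∧ W.treeIdx v = y

/-- The graph obtained from `W` by contracting every VEV tree to a point. -/
def treeGraph : SimpleGraph W.TreeIdx :=
  SimpleGraph.fromRel fun x y => ∃ b, W.TreeLink b x y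

lemma TreeLink.unique {b : S.Bridge} {x y x' y' : W.TreeIdx} (h : W.TreeLink b x y)
    (h' : W.TreeLink b x' y') : x = x' ∧ y = y' := by
  obtain ⟨u, v, ⟨hu, hv⟩, rfl, rfl⟩ := h
  obtain ⟨u', v', ⟨hu', hv'⟩, rfl, rfl⟩ := h'
  exact ⟨hu.treeIdx_eq hu', hv.treeIdx_eq hv'⟩

/-- The root vertex of the tree with a given index. -/
def rootVertex (x : W.TreeIdx) : W.Vertex := ⟨x.1, x.2, ((W.forest x.1).get x.2).rootVertex⟩

lemma reachable_treeIdx {u v : W.Vertex}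
    (h : (∃ e, W.IsLink e u v) ∨ ∃ e, W.IsLink e v u) :
    W.treeGraph.Reachable (W.treeIdx u) (W.treeIdx v) := by
  by_cases hne : W.treeIdx u = W.treeIdx v
  · rw [hne]
  refine SimpleGraph.Adj.reachable ?_
  rw [treeGraph, SimpleGraph.fromRel_adj]
  refine ⟨hne, h.imp ?_ ?_⟩
  · rintro ⟨⟨i, k, e⟩ | b, he⟩
    · obtain ⟨rfl, rfl⟩ := he
      exact absurd rfl hne
    · exact ⟨b, _, _, he, rfl, rfl⟩
  · rintro ⟨⟨i, k, e⟩ | b, he⟩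
    · obtain ⟨rfl, rfl⟩ := he
      exact absurd rfl hne
    · exact ⟨b, _, _, he, rfl, rfl⟩

variable {W}

lemma Connected.treeGraph (hW : W.Connected) : W.treeGraph.Connected := by
  have hreach : ∀ {u v : W.Vertex}, (SimpleGraph.fromRel fun u v : W.Vertex =>
      ∃ e : W.Edge, W.IsLink e u v).Walk u v →
      W.treeGraph.Reachable (W.treeIdx u) (W.treeIdx v) := by
    intro u v p
    induction p with
    | nil => exact SimpleGraph.Reachable.refl _
    | cons h p ih => exact (W.reachable_treeIdx ((SimpleGraph.fromRel_adj _ _ _).1 h).2).trans ih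
  have hne : Nonempty W.TreeIdx := hW.nonempty.map W.treeIdx
  refine SimpleGraph.Connected.mk fun x y => ?_
  obtain ⟨p⟩ := hW.preconnected (W.rootVertex x) (W.rootVertex y)
  exact hreach p

variable (W)

/-- Contracting the VEV trees, which have cycle rank `0`, does not change the cycle rank. -/
lemma cycleRank_eq : W.cycleRank =
    (Fintype.card S.Bridge : ℤ) - (Fintype.card W.TreeIdx : ℤ) + 1 := by
  have hV : Fintype.card W.Vertex = ∑ i, ∑ k, Fintype.card ((W.forest i).get k).Vertex := by
    rw [Fintype.card_sigma]
    exact Finset.sum_congr rfl fun i _ => Fintype.card_sigma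
  have hE : Fintype.card W.Edge =
      (∑ i, ∑ k, Fintype.card ((W.forest i).get k).Edge) + Fintype.card S.Bridge := by
    rw [Fintype.card_sum, Fintype.card_sigma]
    congr 1
    exact Finset.sum_congr rfl fun i _ => Fintype.card_sigma
  have hI : Fintype.card W.TreeIdx = ∑ i, ∑ _k : Fin (W.forest i).length, 1 := by
    rw [Fintype.card_sigma]
    simp
  simp only [VTree.card_vertex, Finset.sum_add_distrib] at hV
  rw [cycleRank, hV, hE, hI]
  push_cast
  ring

/-- All leaves of the tree with index `x` have first label divisible by `e`. -/
def AllDvd (e : ℤ) (x : W.TreeIdx) : Prop := ∀ l ∈ (W.tree x).leaves, e ∣ l.2.1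

variable {W}

/-- A bridge ending at a leaf `v` has label `|c_v|`. -/
lemma dvd_bridgeLabel {e : ℤ} {b : S.Bridge} {x y : W.TreeIdx} (h : W.TreeLink b x y)
    (hxy : W.AllDvd e x ∨ W.AllDvd e y) : e ∣ S.bridgeLabel b := by
  obtain ⟨i, j⟩ := b
  obtain ⟨u, v, ⟨⟨hi, hu⟩, ⟨hi', hv⟩⟩, rfl, rfl⟩ := h
  rcases hxy with hx | hy
  · obtain ⟨l, hl, hlx⟩ := hu.exists_mem_leaves
    subst hi
    have := W.leaf_lamLeft (W.tree_mem (W.treeIdx u)) hl j hlx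
    have h2 := hx l hl
    rw [this] at h2
    exact h2
  · obtain ⟨l, hl, hlx⟩ := hv.exists_mem_leaves
    obtain rfl : i = v.1 + 1 := by rw [hi', sub_add_cancel]
    have := W.leaf_lamRight (W.tree_mem (W.treeIdx v)) hl j hlx
    have h2 := hy l hl
    rw [this] at h2
    exact dvd_neg.1 h2

open Classical in
/-- If `e` does not divide the gcd, some tree has a leaf not divisible by `e`, so the trees all of
whose leaves are divisible form a proper set; all bridges at these have label divisible by `e`. -/
lemma card_allDvd_le (hW : W.Connected) {e : ℕ} (he : ¬ e ∣ S.gcd) :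
    (Finset.univ.filter fun x => W.AllDvd e x).card ≤
      (Finset.univ.filter fun b : S.Bridge => (e : ℤ) ∣ S.bridgeLabel b).card := by
  refine card_le_card_incident hW.treeGraph (link := W.TreeLink) (fun x y h => ?_)
    (fun b x y x' y' h h' => TreeLink.unique W h h') ?_ fun b x y h hxy => dvd_bridgeLabel h hxy
  · rcases ((SimpleGraph.fromRel_adj _ _ _).1 h).2 with ⟨b, hb⟩ | ⟨b, hb⟩
    · exact ⟨b, .inl hb⟩
    · exact ⟨b, .inr hb⟩
  · by_contra! hall
    refine he (W.dvd_gcd fun i T hT => ?_)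
    obtain ⟨k, rfl⟩ := List.mem_iff_get.1 hT
    exact hall ⟨i, k⟩

end CombinedForest
end TopString

/-! ### Zeros and poles of the combined amplitude -/

namespace TopString
namespace CombinedForest

variable {r : ℕ} [NeZero r] {γ : Fin r → ℤ} {S : RSet r} (W : CombinedForest γ S)

/-- The entries `a` of the factors `[a]` in the numerator of `ℋ(W)`. -/
def numer : Multiset ℤ :=
  ∑ x : W.TreeIdx, ((W.tree x).numer : Multiset ℤ) +
    ∑ b : S.Bridge, Multiset.replicate 2 (S.bridgeLabel b : ℤ)

/-- The entries `b` of the factors `[b]` in the denominator of `ℋ(W)`. -/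
def denom : Multiset ℤ := ∑ x : W.TreeIdx, ((W.tree x).denom : Multiset ℤ)

lemma ampB_tree (x : W.TreeIdx) : (W.tree x).ampB = ((W.tree x).scalar : RatFunc ℚ) *
    ((((W.tree x).numer : Multiset ℤ).map qnum).prod /
      (((W.tree x).denom : Multiset ℤ).map qnum).prod) := by
  obtain ⟨-, L, R, h⟩ := W.root_forest (W.tree_mem x)
  rw [h, VTree.ampB_node]
  simp

lemma ampH_eq : ∃ C : ℤ, W.ampH =
    (C : RatFunc ℚ) * ((W.numer.map qnum).prod / (W.denom.map qnum).prod) := by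
  have hprod : ∏ i, ((W.forest i).map VTree.ampB).prod = ∏ x : W.TreeIdx, (W.tree x).ampB := by
    rw [Fintype.prod_sigma]
    refine Finset.prod_congr rfl fun i _ => ?_
    exact (Fin.prod_univ_fun_getElem (W.forest i) VTree.ampB).symm
  obtain ⟨σ, hσ⟩ : ∃ σ : ℤ, ((-1) ^ ((∑ i, ((S.mu i).length : ℤ)) +
      (∑ i, ((S.nu i).length : ℤ)) + ∑ i, γ i * (S.degree i : ℤ)) : RatFunc ℚ) = σ := by
    rw [neg_one_zpow_eq_ite]
    split_ifs
    · exact ⟨1, by simp⟩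
    · exact ⟨-1, by simp⟩
  refine ⟨σ * ∏ x : W.TreeIdx, (W.tree x).scalar, ?_⟩
  rw [ampH, hσ, hprod, numer, denom, Multiset.map_add, Multiset.prod_add, prod_map_qnum_sum,
    prod_map_qnum_sum, prod_map_qnum_sum]
  simp only [ampB_tree, Finset.prod_mul_distrib, Finset.prod_div_distrib, Multiset.map_replicate,
    Multiset.prod_replicate]
  push_cast
  ring

lemma even_card_numer_add_card_denom : Even (W.numer.card + W.denom.card) := by
  rw [numer, denom, Multiset.card_add, Multiset.card_sum, Multiset.card_sum, Multiset.card_sum,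
    add_right_comm, ← Finset.sum_add_distrib]
  refine Even.add (Finset.even_sum _ fun x _ => ?_) (Finset.even_sum _ fun b _ => ?_)
  · obtain ⟨-, L, R, h⟩ := W.root_forest (W.tree_mem x)
    rw [h]
    simpa using VTree.even_length_numer_add_denom L R
  · simp

lemma even_sum_numer_add_sum_denom : Even (W.numer.sum + W.denom.sum) := by
  have hsum : ∀ {I : Type} (s : Finset I) (f : I → Multiset ℤ),
      (∑ x ∈ s, f x).sum = ∑ x ∈ s, (f x).sum := fun s f => by
    rw [← Multiset.coe_sumAddMonoidHom, map_sum]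
  rw [numer, denom, Multiset.sum_add, hsum, hsum, hsum, add_right_comm,
    ← Finset.sum_add_distrib]
  refine Even.add (Finset.even_sum _ fun x _ => ?_) (Finset.even_sum _ fun b _ => ?_)
  · have hT := W.tree_mem x
    have hpar := fun l hl => (W.leaf_label hT (l := l) hl).2
    obtain ⟨hc, L, R, h⟩ := W.root_forest hT
    rw [h] at hc hpar ⊢
    simpa using VTree.even_sum_numer_add_denom hpar hc
  · simp

open Classical in
/-- The poles of the trees, of order two at most, set against the zeros of the factors `[h(b)] ^ 2`. -/
lemma countP_denom_le (e : ℤ) :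
    W.denom.countP (e ∣ ·) + 2 * (Finset.univ.filter fun b : S.Bridge => e ∣ S.bridgeLabel b).card
      ≤ W.numer.countP (e ∣ ·) + 2 * (Finset.univ.filter fun x => W.AllDvd e x).card := by
  have htree : ∀ x : W.TreeIdx, ((W.tree x).denom : Multiset ℤ).countP (e ∣ ·) ≤
      ((W.tree x).numer : Multiset ℤ).countP (e ∣ ·) + 2 * if W.AllDvd e x then 1 else 0 := by
    intro x
    have hT := W.tree_mem x
    have hcn := fun l hl => (W.leaf_label hT (l := l) hl).1
    obtain ⟨hc, L, R, h⟩ := W.root_forest hT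
    rw [AllDvd]
    rw [h] at hc hcn ⊢
    obtain ⟨h1, h2⟩ := VTree.countP_denom_le_add_two (e := e) hcn hc
    split_ifs with hD
    · simpa using h1
    · simpa using h2 hD
  have hbridge : ∀ b : S.Bridge, (Multiset.replicate 2 (S.bridgeLabel b : ℤ)).countP (e ∣ ·) =
      2 * if e ∣ S.bridgeLabel b then 1 else 0 := by
    intro b
    rw [Multiset.countP_eq_card_filter]
    split_ifs with h
    · rw [Multiset.filter_eq_self.2 fun z hz => by rwa [Multiset.eq_of_mem_replicate hz]]
      simp
    · rw [Multiset.filter_eq_nil.2 fun z hz => by rwa [Multiset.eq_of_mem_replicate hz]]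
      simp
  have hsum := Finset.sum_le_sum fun x (_ : x ∈ Finset.univ) => htree x
  rw [Finset.sum_add_distrib, ← Finset.mul_sum, Finset.sum_boole] at hsum
  rw [numer, denom, Multiset.countP_add, countP_sum, countP_sum, countP_sum,
    Finset.sum_congr rfl fun b _ => hbridge b, ← Finset.mul_sum, Finset.sum_boole]
  simp only [Nat.cast_id] at hsum ⊢
  omega

variable {W}

/-- For `e ∤ gcd` there is no pole; for `e ∣ gcd` the order of the pole is at most `2 - 2 β(W)`. -/
lemma countP_denom_le_of_connected (hW : W.Connected) (e : ℕ) :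
    (¬ e ∣ S.gcd → W.denom.countP ((e : ℤ) ∣ ·) ≤ W.numer.countP ((e : ℤ) ∣ ·)) ∧
      (e ∣ S.gcd → (W.denom.countP ((e : ℤ) ∣ ·) : ℤ) + 2 * W.cycleRank ≤
        W.numer.countP ((e : ℤ) ∣ ·) + 2) := by
  classical
  have h := W.countP_denom_le e
  refine ⟨fun he => ?_, fun he => ?_⟩
  · have := card_allDvd_le hW he
    omega
  · have h1 : (Finset.univ.filter fun x => W.AllDvd e x).card ≤ Fintype.card W.TreeIdx :=
      Finset.card_le_univ _
    have h2 : (Finset.univ.filter fun b : S.Bridge => (e : ℤ) ∣ S.bridgeLabel b).card =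
        Fintype.card S.Bridge := by
      rw [Finset.filter_true_of_mem, Finset.card_univ]
      intro b _
      have hb : S.bridgeLabel b ∈ (S.lam b.1).parts := List.get_mem _ _
      have hmem : S.bridgeLabel b ∈
          (S.mu b.1).2.parts + (S.nu b.1).2.parts + (S.lam b.1).2.parts :=
        Multiset.mem_add.2 (.inr (by simpa [Ptn.parts] using hb))
      exact Int.natCast_dvd_natCast.2
        (he.trans ((Finset.gcd_dvd (Finset.mem_univ b.1)).trans (Multiset.gcd_dvd hmem)))
    rw [W.cycleRank_eq]
    omega

end CombinedForest
end TopString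

theorem proposition5p3 (r : ℕ) [NeZero r] (hr : 2 ≤ r) (γ : Fin r → ℤ) (S : TopString.RSet r)
    (W : TopString.CombinedForest γ S) (hW : W.Connected) :
    (W.cycleRank = 0 → TopString.tvar (S.gcd : ℤ) * W.ampH ∈ TopString.Zt) ∧
      (0 < W.cycleRank → W.ampH ∈ TopString.Zt) := by
  obtain ⟨C, hC⟩ := W.ampH_eq
  rw [hC]
  refine ⟨fun hβ => ?_, fun hβ => ?_⟩
  · rw [mul_left_comm]
    refine mul_mem (intCast_mem _ C) ?_
    have hk : TopString.tvar (S.gcd : ℤ) =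
        ((Multiset.replicate 2 (S.gcd : ℤ)).map TopString.qnum).prod := by
      rw [Multiset.map_replicate, Multiset.prod_replicate, TopString.tvar]
    rw [← mul_div_assoc, hk, ← Multiset.prod_add, ← Multiset.map_add]
    refine TopString.prod_qnum_div_mem_Zt ?_ ?_ fun e _ => ?_
    · rw [Multiset.card_add, add_assoc]
      exact (by simp : Even _).add W.even_card_numer_add_card_denom
    · rw [Multiset.sum_add, add_assoc]
      exact (by simp : Even _).add W.even_sum_numer_add_sum_denom
    · obtain ⟨h1, h2⟩ := TopString.CombinedForest.countP_denom_le_of_connected hW e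
      rw [Multiset.countP_add]
      by_cases he : e ∣ S.gcd
      · have h3 : (Multiset.replicate 2 (S.gcd : ℤ)).countP ((e : ℤ) ∣ ·) = 2 := by
          rw [Multiset.countP_eq_card.2, Multiset.card_replicate]
          intro z hz
          rw [Multiset.eq_of_mem_replicate hz]
          exact Int.natCast_dvd_natCast.2 he
        have := h2 he
        omega
      · have := h1 he
        omega
  · refine mul_mem (intCast_mem _ C) ?_
    refine TopString.prod_qnum_div_mem_Zt W.even_card_numer_add_card_denom W.even_sum_numer_add_sum_denom fun e _ => ?_
    obtain ⟨h1, h2⟩ := TopString.CombinedForest.countP_denom_le_of_connected hW e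
    by_cases he : e ∣ S.gcd
    · have := h2 he
      omega
    · exact h1 he
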